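/- **Setting.** Let $(E,[\![\cdot,\cdot]\!]_E,\rho_E)$ be a Lie algebroid (a smooth vector bundle of finite rank) over a smooth finite-dimensional manifold $Q$, let $k$ be a natural number, and let $\mathcal P=\mathbb R^k\times(E\oplus\overset{k}{\cdots}\oplus E)$ and $\mathcal P^*=\mathbb R^k\times(E^*\oplus\overset{k}{\cdots}\oplus E^*)$, with projections to $Q$ and with points $(\mathbf t,\mathbf e_q)=(t^1,\dots,t^k,e_{1},\dots,e_{k})$, $(\mathbf t,\mathbf e^*_q)$. For a fibration $\pi:P\to Q$ let $\mathcal T^EP=\{(a,v)\in E_{\pi(p)}\times T_pP:\ \rho_E(a)=T_p\pi(v)\}$ be the prolongation of $E$ over $\pi$, a Lie algebroid over $P$ with anchor $(a,v)\mapsto v$, whose bracket on the local basis $\mathcal X_\alpha=(e_\alpha,\rho^i_\alpha\partial_{q^i})$, $\mathcal V_\ell=(0,\partial_{u^\ell})$ is $[\mathcal X_\alpha,\mathcal X_\beta]=C^\gamma_{\alpha\beta}\mathcal X_\gamma$, $[\mathcal X_\alpha,\mathcal V_\ell]=[\mathcal V_\ell,\mathcal V_\varphi]=0$; let $d$ be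 its exterior differential. Put $\mathcal Y^B(a,v)=dt^B(v)$ on $\mathcal T^E\mathcal P$ and on $\mathcal T^E\mathcal P^*$. Let $L:\mathcal P\to\mathbb R$ be smooth. For $u\in E_q$ let $u^{v_A}\in T_{(\mathbf t,\mathbf e_q)}\mathcal P$ be the velocity at $s=0$ of $s\mapsto(\mathbf t,e_1,\dots,e_A+su,\dots,e_k)$, and put $$\Theta_L^A(a,v)=dL(a^{v_A}),\quad \Omega_L^A=-d\Theta_L^A,\quad E_L(\mathbf t,\mathbf e_q)=\sum_A dL(e_A^{v_A})-L(\mathbf t,\mathbf e_q).$$ The Legendre transformation $\mathrm{Leg}:\mathcal P\to\mathcal P^*$ is $\mathrm{Leg}(\mathbf t,\mathbf e_q)=(\mathbf t,p_1,\dots,p_k)$ with $p_A(u)=\frac{d}{ds}\big|_{s=0}L(\mathbf t,e_1,\dots,e_A+su,\dots,e_k)$, and $\mathcal T^E\mathrm{Leg}(a,v)=(a,T\mathrm{Leg}(v))$. On $\mathcal T^E\mathcal P^*$ put $\Theta^A_{(\mathbf t,\mathbf e_q^*)}(a,v)=e_A^*(a)$ and $\Omega^A=-d\Theta^A$. A family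 $\xi_L=(\xi_L^1,\dots,\xi_L^k)$ of smooth sections of $\mathcal T^E\mathcal P$ is a solution of the geometric Euler–Lagrange equations if $$\mathcal Y^B(\xi_L^A)=\delta_A^B,\qquad \sum_A\imath_{\xi_L^A}\Omega_L^A=dE_L+\sum_A\frac{\partial L}{\partial t^A}\mathcal Y^A .$$ For $H:\mathcal P^*\to\mathbb R$, a family $\xi_H=(\xi_H^1,\dots,\xi_H^k)$ of smooth sections of $\mathcal T^E\mathcal P^*$ is a solution of the geometric Hamilton equations if $$\mathcal Y^B(\xi_H^A)=\delta_A^B,\qquad \sum_A\imath_{\xi_H^A}\Omega^A=dH-\sum_A\frac{\partial H}{\partial t^A}\mathcal Y^A .$$ A smooth map $\eta$ from $\mathbb R^k$ is an integral section of such a family $\xi$ if $T_{\mathbf t}\eta(\partial_{t^A})$ is the second component of $\xi^A(\eta(\mathbf t))$ for all $\mathbf t$ and $A$. **Theorem.** Let $L$ be hyperregular, i.e. $\mathrm{Leg}$ is a global diffeomorphism, and let $H=E_L\circ\mathrm{Leg}^{-1}$. 1. The relation $\xi_H^A\circ\mathrm{Leg}=\mathcal T^E\mathrm{Leg}\circ\xi_L^A$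 $(1\le A\le k)$ is a bijective correspondence between families $\xi_L$ of $k$ smooth sections of $\mathcal T^E\mathcal P$ and families $\xi_H$ of $k$ smooth sections of $\mathcal T^E\mathcal P^*$. 2. If $\xi_L$ and $\xi_H$ correspond, then $\xi_L$ is a solution of the geometric Euler–Lagrange equations if and only if $\xi_H$ is a solution of the geometric Hamilton equations for $H$; and a map $\eta:\mathbb R^k\to\mathcal P$ is an integral section of $\xi_L$ if and only if $\mathrm{Leg}\circ\eta$ is an integral section of $\xi_H$. 3. Consequently $\eta\mapsto\mathrm{Leg}\circ\eta$ is a bijection from the set of maps $\eta:\mathbb R^k\to\mathcal P$ that are integral sections of some solution $\xi_L$ of the geometric Euler–Lagrange equations onto the set of maps $\psi:\mathbb R^k\to\mathcal P^*$ that are integral sections of some solution $\xi_H$ of the geometric Hamilton equations. -/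

import Mathlib

open Bundle Set FiberBundle
open scoped Manifold ContDiff Topology
noncomputable section
namespace WhitneySum

variable (k : ℕ) {B F : Type*} {E : B → Type*} [NormedAddCommGroup F] [NormedSpace ℝ F]
  [∀ x, AddCommGroup (E x)] [∀ x, Module ℝ (E x)] [TopologicalSpace (TotalSpace F E)]
  [TopologicalSpace B] [∀ x, TopologicalSpace (E x)] [FiberBundle F E] [VectorBundle ℝ F E]

/-- The trivialization of `E ⊕ ⋯ ⊕ E` obtained by applying a trivialization of `E` to each
summand. -/
def pretrivialization (e : Trivialization F (π F E)) [e.IsLinear ℝ] :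
    Pretrivialization (Fin k → F) (π (Fin k → F) (fun x => Fin k → E x)) where
  toFun p := ⟨p.1, fun A => e.continuousLinearMapAt ℝ p.1 (p.2 A)⟩
  invFun p := ⟨p.1, fun A => e.symmL ℝ p.1 (p.2 A)⟩
  source := TotalSpace.proj ⁻¹' e.baseSet
  target := e.baseSet ×ˢ Set.univ
  map_source' := fun ⟨_, _⟩ h => ⟨h, Set.mem_univ _⟩
  map_target' := fun ⟨_, _⟩ h => h.1
  left_inv' := fun ⟨x, v⟩ h => by
    simp only [TotalSpace.mk_inj]
    funext A
    exact e.symmL_continuousLinearMapAt h (v A)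
  right_inv' := fun ⟨x, v⟩ ⟨h, _⟩ => by
    simp only [Prod.mk_right_inj]
    funext A
    exact e.continuousLinearMapAt_symmL h (v A)
  open_target := e.open_baseSet.prod isOpen_univ
  baseSet := e.baseSet
  open_baseSet := e.open_baseSet
  source_eq := rfl
  target_eq := rfl
  proj_toFun _ _ := rfl

instance pretrivialization_isLinear (e : Trivialization F (π F E)) [e.IsLinear ℝ] :
    (pretrivialization k e).IsLinear ℝ where
  linear x _ :=
    { map_add v w := by
        funext A
        exact (e.continuousLinearMapAt ℝ x).map_add (v A) (w A)
      map_smul c v := by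
        funext A
        exact (e.continuousLinearMapAt ℝ x).map_smul c (v A) }

/-- A linear map of `F` applied to each component of an element of `Fin k → F`. -/
def diag (F : Type*) [NormedAddCommGroup F] [NormedSpace ℝ F] : (F →L[ℝ] F) →L[ℝ] ((Fin k → F) →L[ℝ] (Fin k → F)) :=
  LinearMap.mkContinuous
    { toFun := fun T => ContinuousLinearMap.pi fun A => T.comp (ContinuousLinearMap.proj A)
      map_add' := fun _ _ => rfl
      map_smul' := fun _ _ => rfl } 1 (by
    intro T
    rw [one_mul]
    refine ContinuousLinearMap.opNorm_le_bound _ (norm_nonneg T) fun v => ?_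
    refine (pi_norm_le_iff_of_nonneg (by positivity)).2 fun A => ?_
    exact (T.le_opNorm _).trans (by gcongr; exact norm_le_pi_norm v A))

theorem diag_coordChange_apply (e e' : Trivialization F (π F E)) [MemTrivializationAtlas e]
    [MemTrivializationAtlas e'] (b : B) (hb : b ∈ e.baseSet ∩ e'.baseSet) (v : Fin k → F) :
    diag k F (e.coordChangeL ℝ e' b : F →L[ℝ] F) v =
      (pretrivialization k e' ⟨b, (pretrivialization k e).symm b v⟩).2 := by
  have h : (pretrivialization k e).symm b v = fun A => e.symmL ℝ b (v A) :=
    Pretrivialization.symm_apply (pretrivialization k e) hb.1 v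
  rw [h]
  funext A
  change (e.coordChangeL ℝ e' b : F →L[ℝ] F) (v A) =
    e'.continuousLinearMapAt ℝ b (e.symmL ℝ b (v A))
  rw [ContinuousLinearEquiv.coe_coe, e.coordChangeL_apply e' hb, e.symmL_apply hb.1]
  simp [e'.coe_linearMapAt_of_mem hb.2]

variable (F E) in
/-- The Whitney sum `E ⊕ ⋯ ⊕ E` of `k` copies of a vector bundle, with fibre `Fin k → E x`. -/
def vectorPrebundle : VectorPrebundle ℝ (Fin k → F) (fun x => Fin k → E x) where
  pretrivializationAtlas :=
    {e | ∃ (e₁ : Trivialization F (π F E)) (_ : MemTrivializationAtlas e₁),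
        e = pretrivialization k e₁}
  pretrivialization_linear' := by
    rintro _ ⟨e₁, he₁, rfl⟩
    infer_instance
  pretrivializationAt x := pretrivialization k (trivializationAt F E x)
  mem_base_pretrivializationAt x := mem_baseSet_trivializationAt F E x
  pretrivialization_mem_atlas x := ⟨trivializationAt F E x, inferInstance, rfl⟩
  exists_coordChange := by
    rintro _ ⟨e₁, he₁, rfl⟩ _ ⟨e₁', he₁', rfl⟩
    exact ⟨fun b => diag k F (e₁.coordChangeL ℝ e₁' b : F →L[ℝ] F),
      (diag k F).continuous.comp_continuousOn (continuousOn_coordChange ℝ e₁ e₁'),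
      diag_coordChange_apply k e₁ e₁'⟩
  totalSpaceMk_isInducing := by
    intro b
    let L : E b ≃L[ℝ] F :=
      (trivializationAt F E b).continuousLinearEquivAt ℝ b (mem_baseSet_trivializationAt _ _ _)
    let φ : (Fin k → E b) ≃ₜ (Fin k → F) := Homeomorph.piCongrRight fun _ => L.toHomeomorph
    have h : Topology.IsInducing fun x => (b, φ x) :=
      Topology.isInducing_const_prod.mpr φ.isInducing
    convert h using 1
    funext v
    refine Prod.ext rfl ?_
    funext A
    change (trivializationAt F E b).continuousLinearMapAt ℝ b (v A) = L (v A)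
    rw [Trivialization.continuousLinearMapAt_apply,
      Trivialization.coe_linearMapAt_of_mem _ (mem_baseSet_trivializationAt F E b)]
    rfl

instance topologicalSpace : TopologicalSpace (TotalSpace (Fin k → F) (fun x => Fin k → E x)) :=
  (vectorPrebundle k F E).totalSpaceTopology

instance fiberBundle : FiberBundle (Fin k → F) (fun x => Fin k → E x) :=
  (vectorPrebundle k F E).toFiberBundle

instance vectorBundle : VectorBundle ℝ (Fin k → F) (fun x => Fin k → E x) :=
  (vectorPrebundle k F E).toVectorBundle

variable {EB HB : Type*} [NormedAddCommGroup EB] [NormedSpace ℝ EB] [TopologicalSpace HB]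
  {IB : ModelWithCorners ℝ EB HB} [ChartedSpace HB B] {n : ℕ∞ω} [ContMDiffVectorBundle n F E IB]

instance isContMDiff : (vectorPrebundle k F E).IsContMDiff IB n where
  exists_contMDiffCoordChange := by
    rintro _ ⟨e₁, he₁, rfl⟩ _ ⟨e₁', he₁', rfl⟩
    exact ⟨fun b => diag k F (e₁.coordChangeL ℝ e₁' b : F →L[ℝ] F),
      (diag k F).contMDiff.comp_contMDiffOn (contMDiffOn_coordChangeL e₁ e₁'),
      diag_coordChange_apply k e₁ e₁'⟩

instance contMDiffVectorBundle :
    ContMDiffVectorBundle n (Fin k → F) (fun x => Fin k → E x) IB :=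
  (vectorPrebundle k F E).contMDiffVectorBundle IB

end WhitneySum

/-- The derivative `v f` of a real function `f` on a manifold along a tangent vector `v` at `p`. -/
def dirDeriv {EP HP P : Type*} [NormedAddCommGroup EP] [NormedSpace ℝ EP] [TopologicalSpace HP]
    (J : ModelWithCorners ℝ EP HP) [TopologicalSpace P] [ChartedSpace HP P] (f : P → ℝ) (p : P)
    (v : TangentSpace J p) : ℝ :=
  mfderiv J 𝓘(ℝ, ℝ) f p v

/-! ### Lie algebroids -/

section Algebroid

variable (EQ F : Type*) {Q : Type*} (E : Q → Type*)
  [NormedAddCommGroup EQ] [NormedSpace ℝ EQ] [NormedAddCommGroup F] [NormedSpace ℝ F]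
  [TopologicalSpace Q] [ChartedSpace EQ Q] [IsManifold 𝓘(ℝ, EQ) ∞ Q]
  [∀ q, AddCommGroup (E q)] [∀ q, Module ℝ (E q)] [∀ q, TopologicalSpace (E q)]
  [TopologicalSpace (TotalSpace F E)] [FiberBundle F E] [VectorBundle ℝ F E]

/-- `Sec(E)`: the smooth global sections of the vector bundle `E → Q`. -/
abbrev Sec := ContMDiffSection 𝓘(ℝ, EQ) F ∞ E

/-- A Lie algebroid structure on the vector bundle `E → Q`: a smooth bundle map `ρ : E → TQ` over
the identity and a Lie bracket on the real vector space `Sec(E)` such that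
`[σ, f τ] = f [σ, τ] + (ρ(σ) f) τ`. -/
structure LieAlgebroid where
  anchor : ∀ q, E q →ₗ[ℝ] TangentSpace 𝓘(ℝ, EQ) q
  contMDiff_anchor : ContMDiff (𝓘(ℝ, EQ).prod 𝓘(ℝ, F)) 𝓘(ℝ, EQ).tangent ∞
    (fun e : TotalSpace F E => (⟨e.proj, anchor e.proj e.2⟩ : TangentBundle 𝓘(ℝ, EQ) Q))
  bracket : Sec EQ F E →ₗ[ℝ] Sec EQ F E →ₗ[ℝ] Sec EQ F E
  bracket_self : ∀ σ, bracket σ σ = 0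
  jacobi : ∀ σ τ υ,
    bracket σ (bracket τ υ) + bracket τ (bracket υ σ) + bracket υ (bracket σ τ) = 0
  leibniz : ∀ (σ τ fτ : Sec EQ F E) (f : Q → ℝ), ContMDiff 𝓘(ℝ, EQ) 𝓘(ℝ, ℝ) ∞ f →
    (∀ q, fτ q = f q • τ q) → ∀ q, bracket σ fτ q =
      f q • bracket σ τ q + dirDeriv 𝓘(ℝ, EQ) f q (anchor q (σ q)) • τ q

variable {E}
variable [FiniteDimensional ℝ EQ] [T2Space Q]
  [ContMDiffVectorBundle ∞ F E 𝓘(ℝ, EQ)]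

/-- Every vector `u ∈ E q` is the value of a global smooth section that, near `q`, is constant in
the preferred local trivialization of `E` at `q`. -/
theorem exists_sec_eventuallyEq_extend (q : Q) (u : E q) :
    ∃ σ : Sec EQ F E, ∀ᶠ x in 𝓝 q, σ x = extend F u x := by
  obtain ⟨s, hs, hσ⟩ := exists_contMDiffOn_extend (k := ∞) 𝓘(ℝ, EQ) F u
  obtain ⟨U, hUs, hU, hqU⟩ := mem_nhds_iff.1 hs
  obtain ⟨ψ, -, hψ⟩ := (SmoothBumpFunction.nhds_basis_tsupport (I := 𝓘(ℝ, EQ)) q).mem_iff.1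
    (hU.mem_nhds hqU)
  refine ⟨⟨_, ContMDiffOn.smul_section_of_tsupport (ψ := ψ) ψ.contMDiff.contMDiffOn hU hψ
    (hσ.mono hUs)⟩, ?_⟩
  filter_upwards [ψ.eventuallyEq_one] with x hx
  change ψ x • extend F u x = _
  rw [hx]
  exact one_smul _ _

/-- A global smooth section through `u ∈ E q` that is constant near `q` in the preferred local
trivialization of `E` at `q`. -/
def constSec (q : Q) (u : E q) : Sec EQ F E :=
  (exists_sec_eventuallyEq_extend EQ F q u).choose

namespace LieAlgebroid

variable {EQ F}
variable (𝓐 : LieAlgebroid EQ F E)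

/-- The bilinear map `(u, v) ↦ C^γ_{αβ}(q) u^α v^β e_γ(q)` on `E q`, where `(e_α)` is the local
frame given by the preferred trivialization of `E` at `q` and `C^γ_{αβ}` are the structure
functions of the algebroid in this frame. -/
def structureMap (q : Q) (u v : E q) : E q :=
  𝓐.bracket (constSec EQ F q u) (constSec EQ F q v) q

/-! ### The prolongation of a Lie algebroid over a fibration `pr : P → Q` -/

variable {EP HP P : Type*} [NormedAddCommGroup EP] [NormedSpace ℝ EP] [TopologicalSpace HP]
  (J : ModelWithCorners ℝ EP HP) [TopologicalSpace P] [ChartedSpace HP P] (pr : P → Q)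

/-- The fibre at `p` of the prolongation: pairs `(a, v)` with `ρ(a) = T_p pr (v)`. -/
def prolongation (p : P) : Submodule ℝ (E (pr p) × TangentSpace J p) :=
  LinearMap.eqLocus ((𝓐.anchor (pr p)).comp (LinearMap.fst ℝ (E (pr p)) (TangentSpace J p)))
    ((mfderiv J 𝓘(ℝ, EQ) pr p).toLinearMap.comp (LinearMap.snd ℝ (E (pr p)) (TangentSpace J p)))

variable [IsManifold J ∞ P]

/-- A smooth section `p ↦ (a p, v p)` of the prolongation. -/
structure ProlongationSection where
  toFun : ∀ p, 𝓐.prolongation J pr p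
  contMDiff_fst : ContMDiff J (𝓘(ℝ, EQ).prod 𝓘(ℝ, F)) ∞
    (fun p => (⟨pr p, (toFun p).1.1⟩ : TotalSpace F E))
  contMDiff_snd : ContMDiff J J.tangent ∞ (fun p => (⟨p, (toFun p).1.2⟩ : TangentBundle J P))

namespace ProlongationSection

variable {𝓐 J pr}

/-- The component in `E` of a section of the prolongation. -/
def fst (X : 𝓐.ProlongationSection J pr) (p : P) : E (pr p) := (X.toFun p).1.1

/-- The anchor of the prolongation applied to a section: the vector field on `P` that is its
second component. -/
def anchor (X : 𝓐.ProlongationSection J pr) (p : P) : TangentSpace J p := (X.toFun p).1.2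

/-- The derivative at `p`, along the tangent vector `v`, of the coordinates of the first component
of `X` in the preferred local trivialization of `E` at `pr p`. -/
def derivFst (X : 𝓐.ProlongationSection J pr) (p : P) (v : TangentSpace J p) : E (pr p) :=
  (trivializationAt F E (pr p)).symm (pr p)
    (mfderiv J 𝓘(ℝ, F) (fun x => (trivializationAt F E (pr p) ⟨pr x, X.fst x⟩).2) p v)

/-- The Lie bracket of two sections of the prolongation. With a local frame `(e_α)` of `E`,
`X = (a^α e_α, v)` and `Y = (b^α e_α, w)`, it is
`(C^γ_{αβ} a^α b^β e_γ + v(b^γ) e_γ - w(a^γ) e_γ, [v, w])`; on the local basis `𝒳_α, 𝒱_ℓ` this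
gives `[𝒳_α, 𝒳_β] = C^γ_{αβ} 𝒳_γ` and `[𝒳_α, 𝒱_ℓ] = [𝒱_ℓ, 𝒱_φ] = 0`. -/
def bracket (X Y : 𝓐.ProlongationSection J pr) (p : P) : E (pr p) × TangentSpace J p :=
  (𝓐.structureMap (pr p) (X.fst p) (Y.fst p) +
      Y.derivFst p (X.anchor p) - X.derivFst p (Y.anchor p),
    VectorField.mlieBracket J X.anchor Y.anchor p)

end ProlongationSection

/-- The exterior differential of a function on `P`, evaluated on a section of the prolongation. -/
def d₀ (f : P → ℝ) (X : 𝓐.ProlongationSection J pr) (p : P) : ℝ :=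
  dirDeriv J f p (X.anchor p)

/-- The exterior differential `(dΘ)(X, Y) = ρ(X)(Θ(Y)) - ρ(Y)(Θ(X)) - Θ([X, Y])` of a section `Θ` of
the dual of the prolongation. Here `Θ` is given as a family of linear forms on the spaces
`E (pr p) × T_p P` that contain the fibres of the prolongation; only their restrictions to these
fibres matter. -/
def d₁ (Θ : ∀ p, E (pr p) × TangentSpace J p →ₗ[ℝ] ℝ) (X Y : 𝓐.ProlongationSection J pr)
    (p : P) : ℝ :=
  𝓐.d₀ J pr (fun x => Θ x (Y.fst x, Y.anchor x)) X p -
    𝓐.d₀ J pr (fun x => Θ x (X.fst x, X.anchor x)) Y p - Θ p (X.bracket Y p)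

end LieAlgebroid

end Algebroid

/-! ### The manifolds `ℝ^k × (V ⊕ ⋯ ⊕ V)` -/

section Phase

variable (k : ℕ) {EQ F Q : Type*} {V : Q → Type*}
  [NormedAddCommGroup EQ] [NormedSpace ℝ EQ] [NormedAddCommGroup F] [NormedSpace ℝ F]
  [TopologicalSpace Q] [ChartedSpace EQ Q]
  [∀ q, AddCommGroup (V q)] [∀ q, Module ℝ (V q)] [∀ q, TopologicalSpace (V q)]
  [TopologicalSpace (TotalSpace F V)] [FiberBundle F V] [VectorBundle ℝ F V]

variable (F V) in
/-- `ℝ^k × (V ⊕ ⋯ ⊕ V)` (`k` summands) for a vector bundle `V → Q` with model fibre `F`. -/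
abbrev Phase := (Fin k → ℝ) × TotalSpace (Fin k → F) (fun q => Fin k → V q)

variable (EQ F) in
/-- The model with corners of `ℝ^k × (V ⊕ ⋯ ⊕ V)`. -/
abbrev phaseModel := 𝓘(ℝ, Fin k → ℝ).prod (𝓘(ℝ, EQ).prod 𝓘(ℝ, Fin k → F))

variable {k}

/-- The projection `(t, v_q) ↦ q`. -/
abbrev Phase.proj (p : Phase k F V) : Q := p.2.proj

/-- The curve `s ↦ (t, v_1, …, v_A + s u, …, v_k)`. -/
def Phase.shift (p : Phase k F V) (A : Fin k) (u : V p.proj) (s : ℝ) : Phase k F V :=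
  (p.1, ⟨p.2.proj, Function.update p.2.2 A (p.2.2 A + s • u)⟩)

/-- `∂f/∂t^A` at `p`. -/
def timeDeriv (f : Phase k F V → ℝ) (A : Fin k) (p : Phase k F V) : ℝ :=
  deriv (fun s : ℝ => f (p.1 + s • Pi.single A (1 : ℝ), p.2)) 0

variable (EQ) in
/-- `dt^B` at `p`. On the second component of elements of the prolongation this is `𝒴^B`. -/
def dt (B : Fin k) (p : Phase k F V) (v : TangentSpace (phaseModel k EQ F) p) : ℝ :=
  dirDeriv (phaseModel k EQ F) (fun x : Phase k F V => x.1 B) p v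

variable (k EQ F V) in
/-- The points near `p` that differ from `p` only in the `A`-th vector, parametrized by the model
fibre. -/
def Phase.fiberMap (p : Phase k F V) (A : Fin k) (f : F) : Phase k F V :=
  (p.1, ⟨p.2.proj, Function.update p.2.2 A
    ((VectorBundle.continuousLinearEquivAt ℝ F V p.proj).symm f)⟩)

theorem Phase.contMDiff_fiberMap (p : Phase k F V) (A : Fin k) :
    ContMDiff 𝓘(ℝ, F) (phaseModel k EQ F) ∞ (p.fiberMap k F V A) := by
  refine contMDiff_const.prodMk fun f => ?_
  rw [contMDiffAt_totalSpace]
  refine ⟨contMDiffAt_const, ?_⟩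
  rw [contMDiffAt_pi_space]
  intro B
  change ContMDiffAt 𝓘(ℝ, F) 𝓘(ℝ, F) ∞ (fun g : F =>
    (trivializationAt F V p.proj).continuousLinearMapAt ℝ p.proj (Function.update p.2.2 A
      ((VectorBundle.continuousLinearEquivAt ℝ F V p.proj).symm g) B)) f
  rcases eq_or_ne B A with rfl | h
  · simp only [Function.update_self]
    exact (((trivializationAt F V p.proj).continuousLinearMapAt ℝ p.proj).comp
      ((VectorBundle.continuousLinearEquivAt ℝ F V p.proj).symm :
        F →L[ℝ] V p.proj)).contMDiff f
  · simp only [Function.update_of_ne h]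
    exact contMDiffAt_const

theorem Phase.shift_eq_fiberMap (p : Phase k F V) (A : Fin k) (u : V p.proj) :
    p.shift A u = fun s : ℝ => p.fiberMap k F V A
      (VectorBundle.continuousLinearEquivAt ℝ F V p.proj (p.2.2 A) +
        s • VectorBundle.continuousLinearEquivAt ℝ F V p.proj u) := by
  funext s
  simp only [Phase.shift, Phase.fiberMap, map_add, map_smul, ContinuousLinearEquiv.symm_apply_apply]

variable (EQ) in
theorem Phase.mfderiv_shift (p : Phase k F V) (A : Fin k) (u : V p.proj) :
    mfderiv 𝓘(ℝ, ℝ) (phaseModel k EQ F) (p.shift A u) 0 (1 : ℝ) =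
      mfderiv 𝓘(ℝ, F) (phaseModel k EQ F) (p.fiberMap k F V A)
        (VectorBundle.continuousLinearEquivAt ℝ F V p.proj (p.2.2 A))
        (VectorBundle.continuousLinearEquivAt ℝ F V p.proj u) := by
  set c := VectorBundle.continuousLinearEquivAt ℝ F V p.proj (p.2.2 A)
  set w := VectorBundle.continuousLinearEquivAt ℝ F V p.proj u
  have h0 : c + (0 : ℝ) • w = c := by simp
  have hG : HasMFDerivAt 𝓘(ℝ, F) (phaseModel k EQ F) (p.fiberMap k F V A) (c + (0 : ℝ) • w)
      (mfderiv 𝓘(ℝ, F) (phaseModel k EQ F) (p.fiberMap k F V A) (c + (0 : ℝ) • w)) :=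
    ((p.contMDiff_fiberMap A).mdifferentiable (by simp) _).hasMFDerivAt
  have hl : HasFDerivAt (fun s : ℝ => c + s • w)
      ((ContinuousLinearMap.id ℝ ℝ).smulRight w) 0 :=
    ((hasFDerivAt_id (0 : ℝ)).smul_const w).const_add c
  have h := (hG.comp (0 : ℝ) hl.hasMFDerivAt).mfderiv
  rw [p.shift_eq_fiberMap A u]
  change mfderiv 𝓘(ℝ, ℝ) (phaseModel k EQ F)
    ((p.fiberMap k F V A) ∘ fun s : ℝ => c + s • w) 0 (1 : ℝ) = _
  rw [h, h0]
  change mfderiv 𝓘(ℝ, F) (phaseModel k EQ F) (p.fiberMap k F V A) c ((1 : ℝ) • w) = _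
  rw [one_smul]

theorem Phase.deriv_comp_shift {f : Phase k F V → ℝ}
    (hf : ContMDiff (phaseModel k EQ F) 𝓘(ℝ, ℝ) ∞ f) (p : Phase k F V) (A : Fin k)
    (u : V p.proj) :
    deriv (fun s : ℝ => f (p.shift A u s)) 0 =
      fderiv ℝ (fun g : F => f (p.fiberMap k F V A g))
        (VectorBundle.continuousLinearEquivAt ℝ F V p.proj (p.2.2 A))
        (VectorBundle.continuousLinearEquivAt ℝ F V p.proj u) := by
  set c := VectorBundle.continuousLinearEquivAt ℝ F V p.proj (p.2.2 A)
  set w := VectorBundle.continuousLinearEquivAt ℝ F V p.proj u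
  have hG : Differentiable ℝ (fun g : F => f (p.fiberMap k F V A g)) :=
    (contMDiff_iff_contDiff.1 (hf.comp (p.contMDiff_fiberMap A))).differentiable (by simp)
  have hl : HasDerivAt (fun s : ℝ => c + s • w) w 0 := by
    simpa using ((hasDerivAt_id (0 : ℝ)).smul_const w).const_add c
  have h := ((hG (c + (0 : ℝ) • w)).hasFDerivAt.comp_hasDerivAt (0 : ℝ) hl).deriv
  rw [p.shift_eq_fiberMap A u]
  refine h.trans ?_
  rw [zero_smul, add_zero]

variable (EQ) in
/-- The vertical `A`-th lift `(u)^{v_A}_p`: the velocity at `s = 0` of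
`s ↦ (t, v_1, …, v_A + s u, …, v_k)`. -/
def Phase.verticalLift (p : Phase k F V) (A : Fin k) :
    V p.proj →ₗ[ℝ] TangentSpace (phaseModel k EQ F) p where
  toFun u := mfderiv 𝓘(ℝ, ℝ) (phaseModel k EQ F) (p.shift A u) 0 (1 : ℝ)
  map_add' u v := by
    rw [Phase.mfderiv_shift, Phase.mfderiv_shift, Phase.mfderiv_shift, map_add]
    exact map_add (mfderiv 𝓘(ℝ, F) (phaseModel k EQ F) (p.fiberMap k F V A) _) _ _
  map_smul' c u := by
    rw [Phase.mfderiv_shift, Phase.mfderiv_shift, map_smul]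
    exact map_smul (mfderiv 𝓘(ℝ, F) (phaseModel k EQ F) (p.fiberMap k F V A) _) c _

end Phase

/-! ### Lagrangian and Hamiltonian formalisms -/

section FieldTheory

variable (k : ℕ) {EQ F Q : Type*} {E : Q → Type*}
  [NormedAddCommGroup EQ] [NormedSpace ℝ EQ] [NormedAddCommGroup F] [NormedSpace ℝ F]
  [TopologicalSpace Q] [ChartedSpace EQ Q] [IsManifold 𝓘(ℝ, EQ) ∞ Q]
  [∀ q, AddCommGroup (E q)] [∀ q, Module ℝ (E q)] [∀ q, TopologicalSpace (E q)]
  [TopologicalSpace (TotalSpace F E)] [FiberBundle F E] [VectorBundle ℝ F E]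
  [FiniteDimensional ℝ EQ] [T2Space Q] [ContMDiffVectorBundle ∞ F E 𝓘(ℝ, EQ)]

variable (F E) in
/-- `ℝ^k × (E ⊕ ⋯ ⊕ E)`. -/
abbrev VelocityPhase := Phase k F E

variable (F E) in
/-- `ℝ^k × (E^* ⊕ ⋯ ⊕ E^*)`. -/
abbrev MomentumPhase := Phase k (F →L[ℝ] ℝ) (fun q => E q →L[ℝ] ℝ)

variable (EQ F E) in
/-- Smooth Lagrangian functions `L : ℝ^k × (E ⊕ ⋯ ⊕ E) → ℝ`. -/
abbrev Lagrangian := ContMDiffMap (phaseModel k EQ F) 𝓘(ℝ, ℝ) (VelocityPhase k F E) ℝ ∞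

variable {k}

namespace Lagrangian

variable (L : Lagrangian k EQ F E)

/-- The `A`-th component `u ↦ d/ds|_{s=0} L(t, e_1, …, e_A + s u, …, e_k)` of the Legendre
transformation. -/
def legendreComp (p : VelocityPhase k F E) (A : Fin k) : E p.proj →L[ℝ] ℝ where
  toFun u := deriv (fun s : ℝ => L (p.shift A u s)) 0
  map_add' u v := by
    simp only [Phase.deriv_comp_shift L.contMDiff, map_add]
  map_smul' c u := by
    simp only [Phase.deriv_comp_shift L.contMDiff, map_smul, RingHom.id_apply]
  cont := by
    simp only [Phase.deriv_comp_shift L.contMDiff]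
    fun_prop

/-- The Legendre transformation. -/
def legendre (p : VelocityPhase k F E) : MomentumPhase k F E :=
  (p.1, ⟨p.2.proj, fun A => L.legendreComp p A⟩)

/-- `L` is hyperregular: its Legendre transformation is a global diffeomorphism. -/
def IsHyperregular : Prop :=
  ∃ Φ : Diffeomorph (phaseModel k EQ F) (phaseModel k EQ (F →L[ℝ] ℝ))
    (VelocityPhase k F E) (MomentumPhase k F E) ∞, ∀ p, Φ p = L.legendre p

/-- The energy `E_L = ∑_A ρ(Δ_A) L - L`, where the Liouville section `Δ_A` has second component
`(e_A)^{v_A}`. -/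
def energy (p : VelocityPhase k F E) : ℝ :=
  (∑ A, dirDeriv (phaseModel k EQ F) L p (p.verticalLift EQ A (p.2.2 A))) - L p

/-- The Hamiltonian `H = E_L ∘ Leg⁻¹` of a hyperregular Lagrangian. -/
def hamiltonian (hL : L.IsHyperregular) (p : MomentumPhase k F E) : ℝ :=
  L.energy (hL.choose.symm p)

end Lagrangian

/-- The `A`-th vertical endomorphism `(a, v) ↦ (0, a^{v_A})`. -/
def verticalEndomorphism (A : Fin k) (p : VelocityPhase k F E) :
    E p.proj × TangentSpace (phaseModel k EQ F) p →ₗ[ℝ]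
      E p.proj × TangentSpace (phaseModel k EQ F) p :=
  LinearMap.prod 0 ((p.verticalLift EQ A).comp (LinearMap.fst ℝ _ _))

/-- The Poincaré–Cartan `1`-section `Θ_L^A = dL ∘ S^A`. -/
def Lagrangian.theta (L : Lagrangian k EQ F E) (A : Fin k) (p : VelocityPhase k F E) :
    E p.proj × TangentSpace (phaseModel k EQ F) p →ₗ[ℝ] ℝ :=
  (mfderiv (phaseModel k EQ F) 𝓘(ℝ, ℝ) L p).toLinearMap.comp
    ((LinearMap.snd ℝ _ _).comp (verticalEndomorphism A p))

/-- The Liouville `1`-section `Θ^A(a, v) = e_A^*(a)`. -/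
def liouvilleTheta (A : Fin k) (p : MomentumPhase k F E) :
    E p.proj × TangentSpace (phaseModel k EQ (F →L[ℝ] ℝ)) p →ₗ[ℝ] ℝ :=
  (p.2.2 A).toLinearMap.comp (LinearMap.fst ℝ _ _)

namespace LieAlgebroid

variable (𝓐 : LieAlgebroid EQ F E)

variable (k) in
/-- Sections of the Lagrangian prolongation, i.e. of the prolongation of `E` over
`ℝ^k × (E ⊕ ⋯ ⊕ E) → Q`. -/
abbrev LagrangianSection :=
  𝓐.ProlongationSection (phaseModel k EQ F) (Phase.proj : VelocityPhase k F E → Q)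

variable (k) in
/-- Sections of the Hamiltonian prolongation, i.e. of the prolongation of `E` over
`ℝ^k × (E^* ⊕ ⋯ ⊕ E^*) → Q`. -/
abbrev HamiltonianSection :=
  𝓐.ProlongationSection (phaseModel k EQ (F →L[ℝ] ℝ)) (Phase.proj : MomentumPhase k F E → Q)

/-- The Poincaré–Cartan `2`-section `Ω_L^A = -dΘ_L^A`. -/
def omegaL (L : Lagrangian k EQ F E) (A : Fin k) (X Y : 𝓐.LagrangianSection k)
    (p : VelocityPhase k F E) : ℝ :=
  - 𝓐.d₁ _ _ (L.theta A) X Y p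

/-- The Liouville `2`-section `Ω^A = -dΘ^A`. -/
def omega (A : Fin k) (X Y : 𝓐.HamiltonianSection k) (p : MomentumPhase k F E) : ℝ :=
  - 𝓐.d₁ _ _ (liouvilleTheta A) X Y p

/-- `ξ = (ξ_1, …, ξ_k)` solves the geometric Euler–Lagrange equations `𝒴^B(ξ_A) = δ_A^B`,
`∑_A ι_{ξ_A} Ω_L^A = dE_L + ∑_A (∂L/∂t^A) 𝒴^A`. -/
def IsEulerLagrangeSolution (L : Lagrangian k EQ F E) (ξ : Fin k → 𝓐.LagrangianSection k) : Prop :=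
  (∀ A B p, dt EQ B p ((ξ A).anchor p) = if A = B then 1 else 0) ∧
  ∀ (Y : 𝓐.LagrangianSection k) (p : VelocityPhase k F E),
    ∑ A, 𝓐.omegaL L A (ξ A) Y p =
      𝓐.d₀ _ _ L.energy Y p + ∑ A, timeDeriv L A p * dt EQ A p (Y.anchor p)

/-- `ξ = (ξ_1, …, ξ_k)` solves the geometric Hamilton equations `𝒴^B(ξ_A) = δ_A^B`,
`∑_A ι_{ξ_A} Ω^A = dH - ∑_A (∂H/∂t^A) 𝒴^A`. -/
def IsHamiltonSolution (H : MomentumPhase k F E → ℝ) (ξ : Fin k → 𝓐.HamiltonianSection k) : Prop :=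
  (∀ A B p, dt EQ B p ((ξ A).anchor p) = if A = B then 1 else 0) ∧
  ∀ (Y : 𝓐.HamiltonianSection k) (p : MomentumPhase k F E),
    ∑ A, 𝓐.omega A (ξ A) Y p =
      𝓐.d₀ _ _ H Y p - ∑ A, timeDeriv H A p * dt EQ A p (Y.anchor p)

/-- The map `𝒯^E Leg (a, v) = (a, T Leg (v))`. -/
def prolongedLegendre (L : Lagrangian k EQ F E) (p : VelocityPhase k F E)
    (x : E p.proj × TangentSpace (phaseModel k EQ F) p) :
    E (L.legendre p).proj × TangentSpace (phaseModel k EQ (F →L[ℝ] ℝ)) (L.legendre p) :=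
  (x.1, mfderiv (phaseModel k EQ F) (phaseModel k EQ (F →L[ℝ] ℝ)) L.legendre p x.2)

/-- `ξ_H^A ∘ Leg = 𝒯^E Leg ∘ ξ_L^A` for all `A`. -/
def LegendreRelated (L : Lagrangian k EQ F E) (ξL : Fin k → 𝓐.LagrangianSection k)
    (ξH : Fin k → 𝓐.HamiltonianSection k) : Prop :=
  ∀ A p, ((ξH A).toFun (L.legendre p)).1 = prolongedLegendre L p ((ξL A).toFun p).1

end LieAlgebroid

/-- `η : ℝ^k → P` is an integral section of the `k`-vector field `(X_1, …, X_k)` on `P`. -/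
def IsIntegralSection {EP HP P : Type*} [NormedAddCommGroup EP] [NormedSpace ℝ EP]
    [TopologicalSpace HP] (J : ModelWithCorners ℝ EP HP) [TopologicalSpace P] [ChartedSpace HP P]
    (X : Fin k → ∀ p : P, TangentSpace J p) (η : (Fin k → ℝ) → P) : Prop :=
  ContMDiff 𝓘(ℝ, Fin k → ℝ) J ∞ η ∧
    ∀ t A, mfderiv 𝓘(ℝ, Fin k → ℝ) J η t (Pi.single A (1 : ℝ) : Fin k → ℝ) = X A (η t)

end FieldTheory

end

/-! The Legendre transformation is a diffeomorphism that covers the identity of `Q`, so `(a, v) ↦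
(a, TLeg(v))` is an isomorphism of prolongations: it matches smooth sections on the two sides and
commutes with anchors and brackets (`Related.bracket_eq`), hence with the exterior differential
(`d₁_eq_of_related`). Nearly everything is therefore transport of structure. Since `Θ_L^A(a, v) =
dL(a^{v_A}) = p_A(a)`, the form `Θ^A` pulls back to `Θ_L^A`, so `Ω^A` pulls back to `Ω_L^A`;
likewise `H` pulls back to `E_L` and `dt^B` to `dt^B`.

The one term that is not formal is the time derivative, because `∂/∂t^A` freezes the momenta on one
side and the velocities on the other. The identity `∂H/∂t^A ∘ Leg = -∂L/∂t^A`
(`timeDeriv_hamiltonian`) is the envelope argument: along fixed momenta `m`, `H = ∑ m_B(e_B(s)) -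
L(t + s ∂_A, e(s))`, and the terms with `e'` cancel because `m_B` is the partial derivative of `L`
in the `B`-th velocity. This accounts for the opposite signs in the two systems of equations.

Integral sections correspond by the chain rule and the injectivity of `TLeg`. -/

set_option linter.unusedSectionVars false

/-! ### Naturality of derivatives and Lie brackets under a diffeomorphism. -/

section Diffeo

variable {EP HP P EP' HP' P' : Type*} [NormedAddCommGroup EP] [NormedSpace ℝ EP]
  [TopologicalSpace HP] {J : ModelWithCorners ℝ EP HP} [TopologicalSpace P] [ChartedSpace HP P]
  [NormedAddCommGroup EP'] [NormedSpace ℝ EP'] [TopologicalSpace HP']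
  {J' : ModelWithCorners ℝ EP' HP'} [TopologicalSpace P'] [ChartedSpace HP' P']
  (Φ : P ≃ₘ^∞⟮J, J'⟯ P')

/-- The chain rule for `f ∘ Φ` with `Φ` a diffeomorphism; `f` need not be differentiable. -/
theorem Diffeomorph.mfderiv_comp_right {G HG N : Type*} [NormedAddCommGroup G] [NormedSpace ℝ G]
    [TopologicalSpace HG] {K : ModelWithCorners ℝ G HG} [TopologicalSpace N] [ChartedSpace HG N]
    (f : P' → N) (p : P) :
    mfderiv J K (fun x => f (Φ x)) p = (mfderiv J' K f (Φ p)).comp (mfderiv J J' Φ p) := by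
  by_cases hf : MDifferentiableAt J' K f (Φ p)
  · exact mfderiv_comp p hf (Φ.contMDiff.mdifferentiable (by simp) p)
  -- `mfderiv` is `0` by default at a point of non-differentiability. Composing with `Φ.symm` shows
  -- that `f ∘ Φ` fails to be differentiable whenever `f` does, so both sides vanish.
  · rw [mfderiv_zero_of_not_mdifferentiableAt hf, mfderiv_zero_of_not_mdifferentiableAt]
    · exact (ContinuousLinearMap.zero_comp _).symm
    intro h
    refine hf ?_
    have h' : MDifferentiableAt J K (fun x => f (Φ x)) (Φ.symm (Φ p)) := by
      rwa [Φ.symm_apply_apply]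
    have := h'.comp (Φ p) (Φ.symm.contMDiff.mdifferentiable (by simp) (Φ p))
    refine this.congr_of_eventuallyEq (Filter.Eventually.of_forall fun x => ?_)
    simp

theorem Diffeomorph.mfderiv_bijective (p : P) : Function.Bijective (mfderiv J J' Φ p) := by
  rw [← Φ.mfderivToContinuousLinearEquiv_coe (by simp)]
  exact (Φ.mfderivToContinuousLinearEquiv (by simp) p).bijective

theorem dirDeriv_comp_diffeomorph (f : P' → ℝ) (p : P) (v : TangentSpace J p) :
    dirDeriv J (fun x => f (Φ x)) p v = dirDeriv J' f (Φ p) (mfderiv J J' Φ p v) := by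
  unfold dirDeriv
  rw [Φ.mfderiv_comp_right f p]
  rfl

/-- The Lie bracket of vector fields is natural under diffeomorphisms. -/
theorem mlieBracket_of_diffeomorph_related [IsManifold J ∞ P] [IsManifold J' ∞ P']
    [CompleteSpace EP] [CompleteSpace EP']
    {V W : ∀ p : P, TangentSpace J p} {V' W' : ∀ p : P', TangentSpace J' p}
    (hV' : ContMDiff J' J'.tangent ∞ fun p => (⟨p, V' p⟩ : TangentBundle J' P'))
    (hW' : ContMDiff J' J'.tangent ∞ fun p => (⟨p, W' p⟩ : TangentBundle J' P'))
    (hV : ∀ p, V' (Φ p) = mfderiv J J' Φ p (V p)) (hW : ∀ p, W' (Φ p) = mfderiv J J' Φ p (W p))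
    (p : P) :
    VectorField.mlieBracket J' V' W' (Φ p) =
      mfderiv J J' Φ p (VectorField.mlieBracket J V W p) := by
  have two_le : (2 : ℕ∞ω) ≤ ∞ := WithTop.coe_le_coe.2 le_top
  have hinv : ∀ x, (mfderiv J J' Φ x).IsInvertible := fun x =>
    ⟨Φ.mfderivToContinuousLinearEquiv (by simp) x, Φ.mfderivToContinuousLinearEquiv_coe (by simp)⟩
  -- As `TΦ` is invertible, being `Φ`-related means being the pull-back, and brackets are known to
  -- commute with pull-backs.
  have key : ∀ {U : ∀ p : P, TangentSpace J p} {U' : ∀ p : P', TangentSpace J' p},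
      (∀ p, U' (Φ p) = mfderiv J J' Φ p (U p)) → VectorField.mpullback J J' Φ U' = U := by
    intro U U' h
    funext x
    rw [VectorField.mpullback_apply, h x]
    exact (hinv x).inverse_apply_eq.2 rfl
  have : IsManifold J (minSmoothness ℝ 2) P := by
    simp only [minSmoothness_of_isRCLikeNormedField]
    exact IsManifold.of_le (n := ∞) (by exact two_le)
  have : IsManifold J' (minSmoothness ℝ 2) P' := by
    simp only [minSmoothness_of_isRCLikeNormedField]
    exact IsManifold.of_le (n := ∞) (by exact two_le)
  have h := VectorField.mpullback_mlieBracket (I := J) (I' := J') (f := Φ) (x₀ := p) (n := ∞)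
    (V := V') (W := W') (hV'.mdifferentiable (by simp) _) (hW'.mdifferentiable (by simp) _)
    (Φ.contMDiff p) (by simp only [minSmoothness_of_isRCLikeNormedField]; exact two_le)
  rw [key hV, key hW, VectorField.mpullback_apply] at h
  exact ((hinv p).inverse_apply_eq.1 h)

end Diffeo

/-! ### Integral sections under a diffeomorphism. -/

section IntegralSection

variable {k : ℕ} {EP HP P EP' HP' P' : Type*} [NormedAddCommGroup EP] [NormedSpace ℝ EP]
  [TopologicalSpace HP] {J : ModelWithCorners ℝ EP HP} [TopologicalSpace P] [ChartedSpace HP P]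
  [NormedAddCommGroup EP'] [NormedSpace ℝ EP'] [TopologicalSpace HP']
  {J' : ModelWithCorners ℝ EP' HP'} [TopologicalSpace P'] [ChartedSpace HP' P']
  (Φ : P ≃ₘ^∞⟮J, J'⟯ P')

theorem isIntegralSection_comp_diffeomorph_iff {X : Fin k → ∀ p : P, TangentSpace J p}
    {X' : Fin k → ∀ p : P', TangentSpace J' p}
    (h : ∀ A p, X' A (Φ p) = mfderiv J J' Φ p (X A p)) (η : (Fin k → ℝ) → P) :
    IsIntegralSection J X η ↔ IsIntegralSection J' X' (fun t => Φ (η t)) := by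
  unfold IsIntegralSection
  have hs : ContMDiff 𝓘(ℝ, Fin k → ℝ) J ∞ η ↔
      ContMDiff 𝓘(ℝ, Fin k → ℝ) J' ∞ (fun t => Φ (η t)) :=
    (Φ.contMDiff_diffeomorph_comp_iff le_rfl).symm
  rw [← hs]
  refine and_congr_right fun hη => forall₂_congr fun t A => ?_
  have hc : mfderiv 𝓘(ℝ, Fin k → ℝ) J' (fun t => Φ (η t)) t =
      (mfderiv J J' Φ (η t)).comp (mfderiv 𝓘(ℝ, Fin k → ℝ) J η t) :=
    mfderiv_comp t (Φ.contMDiff.mdifferentiable (by simp) _) (hη.mdifferentiable (by simp) _)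
  rw [hc, h]
  exact ((Φ.mfderiv_bijective (η t)).1.eq_iff).symm

end IntegralSection

/-! ### Prolongations, their brackets and differentials under a diffeomorphism over `Q`. -/

namespace LieAlgebroid

variable {EQ F : Type*} {Q : Type*} {E : Q → Type*}
  [NormedAddCommGroup EQ] [NormedSpace ℝ EQ] [NormedAddCommGroup F] [NormedSpace ℝ F]
  [TopologicalSpace Q] [ChartedSpace EQ Q] [IsManifold 𝓘(ℝ, EQ) ∞ Q]
  [∀ q, AddCommGroup (E q)] [∀ q, Module ℝ (E q)] [∀ q, TopologicalSpace (E q)]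
  [TopologicalSpace (TotalSpace F E)] [FiberBundle F E] [VectorBundle ℝ F E]
  [FiniteDimensional ℝ EQ] [T2Space Q] [ContMDiffVectorBundle ∞ F E 𝓘(ℝ, EQ)]
  (𝓐 : LieAlgebroid EQ F E)
  {EP HP P EP' HP' P' : Type*} [NormedAddCommGroup EP] [NormedSpace ℝ EP]
  [TopologicalSpace HP] {J : ModelWithCorners ℝ EP HP} [TopologicalSpace P] [ChartedSpace HP P]
  [NormedAddCommGroup EP'] [NormedSpace ℝ EP'] [TopologicalSpace HP']
  {J' : ModelWithCorners ℝ EP' HP'} [TopologicalSpace P'] [ChartedSpace HP' P']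
  [IsManifold J ∞ P] [IsManifold J' ∞ P']
  (Φ : P ≃ₘ^∞⟮J, J'⟯ P') {pr' : P' → Q}

/-- This is the chain rule for `pr' ∘ Φ`. Taking `pr' ∘ Φ` itself as the projection of `P` puts the
`E`-components over `p` and over `Φ p` in the same fibre by definition, so no transport between
fibres is needed. -/
theorem mem_prolongation_diffeomorph_iff (p : P) (a : E (pr' (Φ p))) (v : TangentSpace J p) :
    (a, mfderiv J J' Φ p v) ∈ 𝓐.prolongation J' pr' (Φ p) ↔
      ((a, v) : E ((pr' ∘ Φ) p) × TangentSpace J p) ∈ 𝓐.prolongation J (pr' ∘ Φ) p := by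
  have h : mfderiv J 𝓘(ℝ, EQ) (pr' ∘ Φ) p =
      (mfderiv J' 𝓘(ℝ, EQ) pr' (Φ p)).comp (mfderiv J J' Φ p) := Φ.mfderiv_comp_right pr' p
  change 𝓐.anchor (pr' (Φ p)) a = mfderiv J' 𝓘(ℝ, EQ) pr' (Φ p) (mfderiv J J' Φ p v) ↔
    𝓐.anchor (pr' (Φ p)) a = mfderiv J 𝓘(ℝ, EQ) (pr' ∘ Φ) p v
  rw [h]
  rfl

namespace ProlongationSection

variable {𝓐}

/-- `X'` is the image of `X` under the map `(a, v) ↦ (a, TΦ(v))` of prolongations. -/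
def Related (X : 𝓐.ProlongationSection J (pr' ∘ Φ)) (X' : 𝓐.ProlongationSection J' pr') : Prop :=
  ∀ p, (X'.toFun (Φ p)).1 = (X.fst p, mfderiv J J' Φ p (X.anchor p))

theorem ext' {pr : P → Q} {X Y : 𝓐.ProlongationSection J pr}
    (h : ∀ p, (X.toFun p).1 = (Y.toFun p).1) : X = Y := by
  cases X
  cases Y
  congr
  funext p
  exact Subtype.ext (h p)

variable {Φ}

theorem Related.fst_eq {X : 𝓐.ProlongationSection J (pr' ∘ Φ)} {X' : 𝓐.ProlongationSection J' pr'}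
    (h : Related Φ X X') (p : P) : X'.fst (Φ p) = X.fst p :=
  congrArg Prod.fst (h p)

theorem Related.anchor_eq {X : 𝓐.ProlongationSection J (pr' ∘ Φ)}
    {X' : 𝓐.ProlongationSection J' pr'} (h : Related Φ X X') (p : P) :
    X'.anchor (Φ p) = mfderiv J J' Φ p (X.anchor p) :=
  congrArg Prod.snd (h p)

theorem Related.right_unique {X : 𝓐.ProlongationSection J (pr' ∘ Φ)}
    {X' Y' : 𝓐.ProlongationSection J' pr'} (hX : Related Φ X X') (hY : Related Φ X Y') :
    X' = Y' :=
  ext' fun q => by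
    obtain ⟨p, rfl⟩ := Φ.surjective q
    exact (hX p).trans (hY p).symm

theorem Related.left_unique {X Y : 𝓐.ProlongationSection J (pr' ∘ Φ)}
    {X' : 𝓐.ProlongationSection J' pr'} (hX : Related Φ X X') (hY : Related Φ Y X') :
    X = Y :=
  ext' fun p => Prod.ext ((hX.fst_eq p).symm.trans (hY.fst_eq p))
    ((Φ.mfderiv_bijective p).1 ((hX.anchor_eq p).symm.trans (hY.anchor_eq p)))

variable (Φ)

theorem exists_related_right (X : 𝓐.ProlongationSection J (pr' ∘ Φ)) :
    ∃ X' : 𝓐.ProlongationSection J' pr', Related Φ X X' := by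
  -- The value at `q` is described by equalities in the total spaces, which avoids casting along `Φ
  -- (Φ.symm q) = q` and has the form needed to deduce smoothness.
  have h : ∀ q, ∃ y : 𝓐.prolongation J' pr' q, ∀ p, Φ p = q →
      (⟨pr' q, y.1.1⟩ : TotalSpace F E) = ⟨pr' (Φ p), X.fst p⟩ ∧
      (⟨q, y.1.2⟩ : TangentBundle J' P') = tangentMap J J' Φ ⟨p, X.anchor p⟩ := by
    intro q
    obtain ⟨p, rfl⟩ := Φ.surjective q
    refine ⟨⟨(X.fst p, mfderiv J J' Φ p (X.anchor p)),
      (𝓐.mem_prolongation_diffeomorph_iff Φ p _ _).2 (X.toFun p).2⟩, fun p₁ hp => ?_⟩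
    obtain rfl := Φ.injective hp
    exact ⟨rfl, rfl⟩
  choose y hy using h
  have hs : ∀ q, Φ (Φ.symm q) = q := Φ.apply_symm_apply
  refine ⟨⟨y, ?_, ?_⟩, fun p => ?_⟩
  · have := X.contMDiff_fst.comp Φ.symm.contMDiff
    exact this.congr fun q => (hy q _ (hs q)).1
  · have := (Φ.contMDiff.contMDiff_tangentMap (m := ∞) (by simp)).comp
      (X.contMDiff_snd.comp Φ.symm.contMDiff)
    exact this.congr fun q => (hy q _ (hs q)).2
  · obtain ⟨h₁, h₂⟩ := hy (Φ p) p rfl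
    exact Prod.ext (TotalSpace.mk_injective _ h₁) (TotalSpace.mk_injective _ h₂)

theorem exists_related_left (X' : 𝓐.ProlongationSection J' pr') :
    ∃ X : 𝓐.ProlongationSection J (pr' ∘ Φ), Related Φ X X' := by
  choose v hv using fun p => (Φ.mfderiv_bijective p).2 (X'.anchor (Φ p))
  refine ⟨⟨fun p => ⟨(X'.fst (Φ p), v p), (𝓐.mem_prolongation_diffeomorph_iff Φ p _ _).1 ?_⟩,
    ?_, ?_⟩, fun p => ?_⟩
  · rw [hv]
    exact (X'.toFun (Φ p)).2
  · exact X'.contMDiff_fst.comp Φ.contMDiff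
  · have := (Φ.symm.contMDiff.contMDiff_tangentMap (m := ∞) (by simp)).comp
      (X'.contMDiff_snd.comp Φ.contMDiff)
    -- The pointwise choice `v` is smooth because `p ↦ (p, v p)` is `TΦ⁻¹ ∘ X' ∘ Φ`; this uses `TΦ⁻¹
    -- ∘ TΦ = id`.
    refine this.congr fun p => ?_
    change (⟨p, v p⟩ : TangentBundle J P) =
      tangentMap J' J Φ.symm ⟨Φ p, X'.anchor (Φ p)⟩
    rw [← hv p]
    change _ = tangentMap J' J Φ.symm (tangentMap J J' Φ ⟨p, v p⟩)
    have hc := tangentMap_comp (I := J) (I' := J') (I'' := J) (f := Φ) (g := Φ.symm)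
      (Φ.symm.contMDiff.mdifferentiable (by simp)) (Φ.contMDiff.mdifferentiable (by simp))
    have hi : Φ.symm ∘ Φ = id := funext Φ.symm_apply_apply
    rw [hi, tangentMap_id] at hc
    exact congrFun hc ⟨p, v p⟩
  · exact Prod.ext rfl (hv p).symm

variable {Φ}

theorem Related.derivFst_eq {X : 𝓐.ProlongationSection J (pr' ∘ Φ)}
    {X' : 𝓐.ProlongationSection J' pr'} (h : Related Φ X X') (p : P) (v : TangentSpace J p) :
    X'.derivFst (Φ p) (mfderiv J J' Φ p v) = X.derivFst p v := by
  -- Both derivatives use the trivialization at the same point of `Q`, so the two coordinate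
  -- functions differ only by composition with `Φ`.
  have hf : (fun x => (trivializationAt F E (pr' (Φ p)) ⟨(pr' ∘ Φ) x, X.fst x⟩).2) =
      fun x => (trivializationAt F E (pr' (Φ p)) ⟨pr' (Φ x), X'.fst (Φ x)⟩).2 := by
    funext x
    rw [h.fst_eq x]
    rfl
  unfold derivFst
  have := Φ.mfderiv_comp_right (K := 𝓘(ℝ, F))
    (fun x => (trivializationAt F E (pr' (Φ p)) ⟨pr' x, X'.fst x⟩).2) p
  rw [← hf] at this
  change _ = (trivializationAt F E (pr' (Φ p))).symm (pr' (Φ p)) (mfderiv J 𝓘(ℝ, F)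
    (fun x => (trivializationAt F E (pr' (Φ p)) ⟨(pr' ∘ Φ) x, X.fst x⟩).2) p v)
  rw [this]
  rfl

/-- The map `(a, v) ↦ (a, TΦ(v))` of prolongations commutes with the brackets. -/
theorem Related.bracket_eq [CompleteSpace EP] [CompleteSpace EP']
    {X Y : 𝓐.ProlongationSection J (pr' ∘ Φ)} {X' Y' : 𝓐.ProlongationSection J' pr'}
    (hX : Related Φ X X') (hY : Related Φ Y Y') (p : P) :
    X'.bracket Y' (Φ p) = ((X.bracket Y p).1, mfderiv J J' Φ p (X.bracket Y p).2) := by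
  refine Prod.ext ?_ ?_
  · change 𝓐.structureMap (pr' (Φ p)) (X'.fst (Φ p)) (Y'.fst (Φ p)) +
      Y'.derivFst (Φ p) (X'.anchor (Φ p)) - X'.derivFst (Φ p) (Y'.anchor (Φ p)) = _
    rw [hX.anchor_eq, hY.anchor_eq, hX.derivFst_eq, hY.derivFst_eq, hX.fst_eq, hY.fst_eq]
    rfl
  · exact mlieBracket_of_diffeomorph_related Φ X'.contMDiff_snd Y'.contMDiff_snd
      hX.anchor_eq hY.anchor_eq p

end ProlongationSection

variable {Φ}

theorem d₀_eq_of_related {X : 𝓐.ProlongationSection J (pr' ∘ Φ)}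
    {X' : 𝓐.ProlongationSection J' pr'} (h : X.Related Φ X') (f : P' → ℝ) (p : P) :
    𝓐.d₀ J' pr' f X' (Φ p) = 𝓐.d₀ J (pr' ∘ Φ) (fun x => f (Φ x)) X p := by
  unfold d₀
  rw [dirDeriv_comp_diffeomorph, h.anchor_eq]

/-- The exterior differential of `1`-sections commutes with the pull-back along
`(a, v) ↦ (a, TΦ(v))`. -/
theorem d₁_eq_of_related [CompleteSpace EP] [CompleteSpace EP']
    {Θ : ∀ p, E ((pr' ∘ Φ) p) × TangentSpace J p →ₗ[ℝ] ℝ}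
    {Θ' : ∀ p, E (pr' p) × TangentSpace J' p →ₗ[ℝ] ℝ}
    (hΘ : ∀ p (a : E (pr' (Φ p))) (v : TangentSpace J p),
      Θ' (Φ p) (a, mfderiv J J' Φ p v) = Θ p (a, v))
    {X Y : 𝓐.ProlongationSection J (pr' ∘ Φ)} {X' Y' : 𝓐.ProlongationSection J' pr'}
    (hX : X.Related Φ X') (hY : Y.Related Φ Y') (p : P) :
    𝓐.d₁ J' pr' Θ' X' Y' (Φ p) = 𝓐.d₁ J (pr' ∘ Φ) Θ X Y p := by
  have key : ∀ {Z : 𝓐.ProlongationSection J (pr' ∘ Φ)} {Z' : 𝓐.ProlongationSection J' pr'},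
      Z.Related Φ Z' → (fun x => Θ' (Φ x) (Z'.fst (Φ x), Z'.anchor (Φ x))) =
        fun x => Θ x (Z.fst x, Z.anchor x) := fun h => by
    funext x
    rw [h.fst_eq, h.anchor_eq, hΘ]
  unfold d₁
  rw [𝓐.d₀_eq_of_related hX, 𝓐.d₀_eq_of_related hY, key hX, key hY, hX.bracket_eq hY, hΘ]

end LieAlgebroid

/-- The derivative of `f` along the velocity of a curve. -/
theorem dirDeriv_mfderiv_curve {EP HP P : Type*} [NormedAddCommGroup EP] [NormedSpace ℝ EP]
    [TopologicalSpace HP] {J : ModelWithCorners ℝ EP HP} [TopologicalSpace P] [ChartedSpace HP P]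
    {f : P → ℝ} {c : ℝ → P} {p : P} (h : c 0 = p) (hf : MDifferentiableAt J 𝓘(ℝ, ℝ) f p)
    (hc : MDifferentiableAt 𝓘(ℝ, ℝ) J c 0) :
    dirDeriv J f p (mfderiv 𝓘(ℝ, ℝ) J c 0 (1 : ℝ)) = deriv (fun s => f (c s)) 0 := by
  subst h
  have := mfderiv_comp (0 : ℝ) hf hc
  rw [mfderiv_eq_fderiv] at this
  exact (congrArg (fun T : ℝ →L[ℝ] ℝ => T 1) this).symm

/-! ### A single fibre of `ℝ^k × (V ⊕ ⋯ ⊕ V) → Q` as a normed space. -/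

section Phase

variable {k : ℕ} {EQ F Q : Type*} {V : Q → Type*}
  [NormedAddCommGroup EQ] [NormedSpace ℝ EQ] [NormedAddCommGroup F] [NormedSpace ℝ F]
  [TopologicalSpace Q] [ChartedSpace EQ Q]
  [∀ q, AddCommGroup (V q)] [∀ q, Module ℝ (V q)] [∀ q, TopologicalSpace (V q)]
  [TopologicalSpace (TotalSpace F V)] [FiberBundle F V] [VectorBundle ℝ F V]

namespace Phase

theorem contMDiff_shift (p : Phase k F V) (A : Fin k) (u : V p.proj) :
    ContMDiff 𝓘(ℝ, ℝ) (phaseModel k EQ F) ∞ (p.shift A u) := by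
  rw [p.shift_eq_fiberMap A u]
  have : ContDiff ℝ ∞ fun s : ℝ => VectorBundle.continuousLinearEquivAt ℝ F V p.proj (p.2.2 A) +
      s • VectorBundle.continuousLinearEquivAt ℝ F V p.proj u := by fun_prop
  exact (p.contMDiff_fiberMap A).comp this.contMDiff

theorem shift_zero (p : Phase k F V) (A : Fin k) (u : V p.proj) : p.shift A u 0 = p := by
  simp [Phase.shift]

variable (k F V) in
/-- Linear coordinates on the fibre of `ℝ^k × (V ⊕ ⋯ ⊕ V) → Q` over `q`. -/
noncomputable def ofFiber (q : Q) (x : (Fin k → ℝ) × (Fin k → F)) : Phase k F V :=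
  (x.1, ⟨q, fun A => (VectorBundle.continuousLinearEquivAt ℝ F V q).symm (x.2 A)⟩)

theorem ofFiber_continuousLinearEquivAt (q : Q) (t : Fin k → ℝ) (e : Fin k → V q) :
    ofFiber k F V q (t, fun B => VectorBundle.continuousLinearEquivAt ℝ F V q (e B)) =
      (t, ⟨q, e⟩) := by
  simp only [ofFiber, ContinuousLinearEquiv.symm_apply_apply]

theorem contMDiff_ofFiber (q : Q) :
    ContMDiff 𝓘(ℝ, (Fin k → ℝ) × (Fin k → F)) (phaseModel k EQ F) ∞ (ofFiber k F V q) := by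
  refine contDiff_fst.contMDiff.prodMk fun x => ?_
  rw [contMDiffAt_totalSpace]
  refine ⟨contMDiffAt_const, ?_⟩
  rw [contMDiffAt_pi_space]
  intro B
  change ContMDiffAt _ 𝓘(ℝ, F) ∞ (fun y : (Fin k → ℝ) × (Fin k → F) =>
    (trivializationAt F V q).continuousLinearMapAt ℝ q
      ((VectorBundle.continuousLinearEquivAt ℝ F V q).symm (y.2 B))) x
  have : ContDiff ℝ ∞ (fun y : (Fin k → ℝ) × (Fin k → F) =>
    (((trivializationAt F V q).continuousLinearMapAt ℝ q).comp
      ((VectorBundle.continuousLinearEquivAt ℝ F V q).symm : F →L[ℝ] V q)) (y.2 B)) := by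
    fun_prop
  exact this.contMDiff x

theorem shift_eq_ofFiber (p : Phase k F V) (A : Fin k) (u : V p.proj) (s : ℝ) :
    p.shift A u s = ofFiber k F V p.proj
      (p.1, (fun B => VectorBundle.continuousLinearEquivAt ℝ F V p.proj (p.2.2 B)) +
        s • (Pi.single A (VectorBundle.continuousLinearEquivAt ℝ F V p.proj u) : Fin k → F)) := by
  unfold shift ofFiber
  congr 2
  funext B
  rcases eq_or_ne B A with rfl | h
  · simp only [Function.update_self, Pi.add_apply, Pi.smul_apply, Pi.single_eq_same, map_add,
      map_smul, ContinuousLinearEquiv.symm_apply_apply]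
  · simp only [Function.update_of_ne h, Pi.add_apply, Pi.smul_apply, Pi.single_eq_of_ne h, smul_zero,
      add_zero, ContinuousLinearEquiv.symm_apply_apply]

/-- Along a differentiable curve in `ℝ^k × (V ⊕ ⋯ ⊕ V)` that stays in one fibre over `Q`, the linear
fibre coordinates are differentiable. -/
theorem differentiableAt_fiberCoord {q : Q} {t : ℝ → Fin k → ℝ} {e : ℝ → Fin k → V q} {s : ℝ}
    (h : MDifferentiableAt 𝓘(ℝ, ℝ) (phaseModel k EQ F)
      (fun s => ((t s, ⟨q, e s⟩) : Phase k F V)) s) :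
    DifferentiableAt ℝ
      (fun s B => VectorBundle.continuousLinearEquivAt ℝ F V q (e s B)) s := by
  have h2 := mdifferentiableAt_snd.comp s h
  have h3 := ((mdifferentiableAt_totalSpace _ _).1 h2).2
  rw [mdifferentiableAt_iff_differentiableAt] at h3
  refine h3.congr_of_eventuallyEq (Filter.Eventually.of_forall fun s => ?_)
  funext B
  change _ = (trivializationAt F V q).continuousLinearMapAt ℝ q (e s B)
  rw [Trivialization.continuousLinearMapAt_apply,
    Trivialization.coe_linearMapAt_of_mem _ (mem_baseSet_trivializationAt F V q)]
  rfl

end Phase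

end Phase

/-! ### The Legendre transformation: energy, Hamiltonian, canonical forms. -/

section FieldTheory

variable {k : ℕ} {EQ F Q : Type*} {E : Q → Type*}
  [NormedAddCommGroup EQ] [NormedSpace ℝ EQ] [NormedAddCommGroup F] [NormedSpace ℝ F]
  [TopologicalSpace Q] [ChartedSpace EQ Q] [IsManifold 𝓘(ℝ, EQ) ∞ Q]
  [∀ q, AddCommGroup (E q)] [∀ q, Module ℝ (E q)] [∀ q, TopologicalSpace (E q)]
  [TopologicalSpace (TotalSpace F E)] [FiberBundle F E] [VectorBundle ℝ F E]
  [FiniteDimensional ℝ EQ] [T2Space Q] [ContMDiffVectorBundle ∞ F E 𝓘(ℝ, EQ)]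

namespace Lagrangian

variable (L : Lagrangian k EQ F E)

theorem dirDeriv_verticalLift (p : VelocityPhase k F E) (A : Fin k) (u : E p.proj) :
    dirDeriv (phaseModel k EQ F) L p (p.verticalLift EQ A u) = L.legendreComp p A u :=
  dirDeriv_mfderiv_curve (p.shift_zero A u) (L.contMDiff.mdifferentiable (by simp) p)
    ((p.contMDiff_shift A u).mdifferentiable (by simp) 0)

theorem energy_eq (p : VelocityPhase k F E) :
    L.energy p = ∑ A, L.legendreComp p A (p.2.2 A) - L p := by
  unfold energy
  simp only [dirDeriv_verticalLift]

theorem differentiable_comp_ofFiber (q : Q) :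
    Differentiable ℝ fun x => L (Phase.ofFiber k F E q x) :=
  (contMDiff_iff_contDiff.1 (L.contMDiff.comp (Phase.contMDiff_ofFiber q))).differentiable
    (by simp)

/-- Together with `timeDeriv_eq_fderiv`, this expresses all partial derivatives of `L` along a fibre
through one total derivative, so that linearity can recombine them in `timeDeriv_hamiltonian`. -/
theorem legendreComp_eq_fderiv (p : VelocityPhase k F E) (A : Fin k) (u : E p.proj) :
    L.legendreComp p A u = fderiv ℝ (fun x => L (Phase.ofFiber k F E p.proj x))
      (p.1, fun B => VectorBundle.continuousLinearEquivAt ℝ F E p.proj (p.2.2 B))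
      (0, Pi.single A (VectorBundle.continuousLinearEquivAt ℝ F E p.proj u)) := by
  set w : Fin k → F := fun B => VectorBundle.continuousLinearEquivAt ℝ F E p.proj (p.2.2 B)
  set v : Fin k → F := Pi.single A (VectorBundle.continuousLinearEquivAt ℝ F E p.proj u)
  have hl : HasDerivAt (fun s : ℝ => (p.1, w + s • v)) (0, v) 0 := by
    refine (hasDerivAt_const _ _).prodMk ?_
    simpa using ((hasDerivAt_id (0 : ℝ)).smul_const v).const_add w
  have h := (L.differentiable_comp_ofFiber p.proj (p.1, w + (0 : ℝ) • v)).hasFDerivAt.comp_hasDerivAt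
    (0 : ℝ) hl
  rw [zero_smul, add_zero] at h
  refine Eq.trans ?_ h.deriv
  change deriv _ 0 = _
  congr 1
  funext s
  rw [Phase.shift_eq_ofFiber p A u s]
  rfl

theorem timeDeriv_eq_fderiv (p : VelocityPhase k F E) (A : Fin k) :
    timeDeriv L A p = fderiv ℝ (fun x => L (Phase.ofFiber k F E p.proj x))
      (p.1, fun B => VectorBundle.continuousLinearEquivAt ℝ F E p.proj (p.2.2 B))
      (Pi.single A 1, 0) := by
  set w : Fin k → F := fun B => VectorBundle.continuousLinearEquivAt ℝ F E p.proj (p.2.2 B)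
  set v : Fin k → ℝ := Pi.single A 1
  have hl : HasDerivAt (fun s : ℝ => (p.1 + s • v, w)) (v, 0) 0 := by
    refine HasDerivAt.prodMk ?_ (hasDerivAt_const _ _)
    simpa using ((hasDerivAt_id (0 : ℝ)).smul_const v).const_add p.1
  have h := (L.differentiable_comp_ofFiber p.proj (p.1 + (0 : ℝ) • v, w)).hasFDerivAt.comp_hasDerivAt
    (0 : ℝ) hl
  rw [zero_smul, add_zero] at h
  refine Eq.trans ?_ h.deriv
  change deriv _ 0 = _
  congr 1
  funext s
  change L (p.1 + s • v, p.2) = L (Phase.ofFiber k F E p.proj (p.1 + s • v, w))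
  rw [Phase.ofFiber_continuousLinearEquivAt]

variable {L}

/-- The Legendre transformation of a hyperregular Lagrangian as a diffeomorphism. -/
noncomputable def IsHyperregular.diffeomorph (hL : L.IsHyperregular) :
    VelocityPhase k F E ≃ₘ^∞⟮phaseModel k EQ F, phaseModel k EQ (F →L[ℝ] ℝ)⟯
      MomentumPhase k F E where
  toFun := L.legendre
  -- The same inverse as in `hamiltonian`, so that `H` is by definition the energy composed with the
  -- inverse of this diffeomorphism.
  invFun := hL.choose.symm
  left_inv p := by rw [← hL.choose_spec p, Diffeomorph.symm_apply_apply]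
  right_inv p := by rw [← hL.choose_spec, Diffeomorph.apply_symm_apply]
  contMDiff_toFun := hL.choose.contMDiff.congr fun p => (hL.choose_spec p).symm
  contMDiff_invFun := hL.choose.symm.contMDiff

theorem hamiltonian_legendre (hL : L.IsHyperregular) (p : VelocityPhase k F E) :
    L.hamiltonian hL (L.legendre p) = L.energy p :=
  congrArg L.energy (hL.diffeomorph.symm_apply_apply p)

/-- `∂H/∂t^A ∘ Leg = -∂L/∂t^A`. -/
theorem timeDeriv_hamiltonian (hL : L.IsHyperregular) (A : Fin k) (p : VelocityPhase k F E) :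
    timeDeriv (L.hamiltonian hL) A (L.legendre p) = -timeDeriv L A p := by
  obtain ⟨t, q, e₀⟩ := p
  set v : Fin k → ℝ := Pi.single A 1 with hv
  set m : Fin k → (E q →L[ℝ] ℝ) := fun B => L.legendreComp (t, ⟨q, e₀⟩) B with hm
  set φ := VectorBundle.continuousLinearEquivAt ℝ F E q
  let y : ℝ → MomentumPhase k F E := fun s => (t + s • v, ⟨q, m⟩)
  have hy : ContMDiff 𝓘(ℝ, ℝ) (phaseModel k EQ (F →L[ℝ] ℝ)) ∞ y :=
    ContMDiff.prodMk (ContDiff.contMDiff (by fun_prop)) contMDiff_const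
  -- The curve `y` keeps the momenta fixed. As `Leg` preserves `t` and `q`, its preimage stays in
  -- the fibre over `q` and is described by velocities `e s`.
  have hex : ∀ s, ∃ e : Fin k → E q, L.legendre (t + s • v, ⟨q, e⟩) = y s := by
    intro s
    obtain ⟨⟨t', q', e⟩, h⟩ := hL.diffeomorph.surjective (y s)
    obtain rfl : t' = t + s • v := congrArg Prod.fst h
    obtain rfl : q' = q := congrArg (fun z => z.2.proj) h
    exact ⟨e, h⟩
  choose e he using hex
  let c : ℝ → VelocityPhase k F E := fun s => (t + s • v, ⟨q, e s⟩)
  have hc : ∀ s, hL.diffeomorph.symm (y s) = c s := fun s => by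
    rw [← he s]
    exact hL.diffeomorph.symm_apply_apply _
  have hcd : ContMDiff 𝓘(ℝ, ℝ) (phaseModel k EQ F) ∞ c :=
    (hL.diffeomorph.symm.contMDiff.comp hy).congr fun s => (hc s).symm
  have hcomp : ∀ s B, L.legendreComp (c s) B = m B := fun s B =>
    congrFun (TotalSpace.mk_injective q (congrArg Prod.snd (he s))) B
  have h0 : e 0 = e₀ := by
    have : L.legendre (t + (0 : ℝ) • v, ⟨q, e 0⟩) = L.legendre (t, ⟨q, e₀⟩) := by
      rw [he 0]
      simp only [y, zero_smul, add_zero]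
      rfl
    exact TotalSpace.mk_injective q (congrArg Prod.snd (hL.diffeomorph.injective this))
  let w : ℝ → Fin k → F := fun s B => φ (e s B)
  -- Smoothness of `Leg⁻¹` is what makes the pointwise chosen velocities differentiable in `s`.
  have hw : HasDerivAt w (deriv w 0) 0 :=
    (Phase.differentiableAt_fiberCoord (hcd.mdifferentiable (by simp) 0)).hasDerivAt
  set G := fun x => L (Phase.ofFiber k F E q x)
  have hH : ∀ s, L.hamiltonian hL (y s) = ∑ B, m B (φ.symm (w s B)) - G (t + s • v, w s) := by
    intro s
    have h1 : L.hamiltonian hL (y s) = L.energy (c s) := congrArg L.energy (hc s)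
    rw [h1, L.energy_eq]
    simp only [hcomp]
    have h2 : G (t + s • v, w s) = L (c s) :=
      congrArg L (Phase.ofFiber_continuousLinearEquivAt q _ _)
    simp only [h2, w, ContinuousLinearEquiv.symm_apply_apply]
    rfl
  have hG : HasDerivAt (fun s => G (t + s • v, w s)) (fderiv ℝ G (t, w 0) (v, deriv w 0)) 0 := by
    have hl : HasDerivAt (fun s : ℝ => (t + s • v, w s)) (v, deriv w 0) 0 := by
      refine HasDerivAt.prodMk ?_ hw
      simpa using ((hasDerivAt_id (0 : ℝ)).smul_const v).const_add t
    have h := (L.differentiable_comp_ofFiber q (t + (0 : ℝ) • v, w 0)).hasFDerivAt.comp_hasDerivAt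
      (0 : ℝ) hl
    rwa [zero_smul, add_zero] at h
  have hS : HasDerivAt (fun s => ∑ B, m B (φ.symm (w s B))) (∑ B, m B (φ.symm (deriv w 0 B))) 0 := by
    refine HasDerivAt.fun_sum fun B _ => ?_
    exact ((m B).comp (φ.symm : F →L[ℝ] E q)).hasFDerivAt.comp_hasDerivAt (0 : ℝ)
      (hasDerivAt_pi.1 hw B)
  have hd : timeDeriv (L.hamiltonian hL) A (L.legendre (t, ⟨q, e₀⟩)) =
      ∑ B, m B (φ.symm (deriv w 0 B)) - fderiv ℝ G (t, w 0) (v, deriv w 0) := by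
    refine Eq.trans ?_ (hS.sub hG).deriv
    change deriv (fun s => L.hamiltonian hL (y s)) 0 = _
    congr 1
    funext s
    exact hH s
  -- The frozen momentum `m B` is the partial derivative of `L` in the `B`-th velocity at `s = 0`.
  -- Hence the sum in `hd` cancels the velocity part of the derivative of `G`, leaving `-∂L/∂t^A`.
  have hm' : ∀ B, m B (φ.symm (deriv w 0 B)) =
      fderiv ℝ G (t, w 0) (0, Pi.single B (deriv w 0 B)) := fun B => by
    have h := L.legendreComp_eq_fderiv (t, ⟨q, e₀⟩) B (φ.symm (deriv w 0 B))
    simp only [φ, ContinuousLinearEquiv.apply_symm_apply] at h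
    refine h.trans ?_
    simp only [w, h0]
    rfl
  have hsum : ((v, deriv w 0) : (Fin k → ℝ) × (Fin k → F)) =
      (v, 0) + ∑ B, (0, Pi.single B (deriv w 0 B)) := by
    refine Prod.ext ?_ ?_
    · simp [Prod.fst_sum]
    · simp [Prod.snd_sum, Finset.univ_sum_single]
  rw [hd, hsum, map_add, map_sum, L.timeDeriv_eq_fderiv]
  simp only [hm', w, h0]
  change _ = -(fderiv ℝ G (t, fun B => φ (e₀ B)) (v, 0))
  ring

/-- Both forms see only `a`, so `v` and `v'` are arbitrary; the common value is the momentum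
`p_A(a)`. -/
theorem liouvilleTheta_legendre (A : Fin k) (p : VelocityPhase k F E) (a : E p.proj)
    (v : TangentSpace (phaseModel k EQ F) p)
    (v' : TangentSpace (phaseModel k EQ (F →L[ℝ] ℝ)) (L.legendre p)) :
    liouvilleTheta (EQ := EQ) A (L.legendre p) (a, v') = L.theta A p (a, v) :=
  (L.dirDeriv_verticalLift p A a).symm

theorem dt_mfderiv_legendre (hL : L.IsHyperregular) (B : Fin k) (p : VelocityPhase k F E)
    (v : TangentSpace (phaseModel k EQ F) p) :
    dt EQ B (L.legendre p)
      (mfderiv (phaseModel k EQ F) (phaseModel k EQ (F →L[ℝ] ℝ)) L.legendre p v) = dt EQ B p v :=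
  (dirDeriv_comp_diffeomorph hL.diffeomorph (fun x => x.1 B) p v).symm

end Lagrangian

/-! ### Equivalence of the Euler–Lagrange and Hamilton equations. -/

namespace LieAlgebroid

variable (𝓐 : LieAlgebroid EQ F E) {L : Lagrangian k EQ F E} (hL : L.IsHyperregular)
open ProlongationSection

theorem legendreRelated_iff {ξL : Fin k → 𝓐.LagrangianSection k}
    {ξH : Fin k → 𝓐.HamiltonianSection k} :
    𝓐.LegendreRelated L ξL ξH ↔
      ∀ A, Related (pr' := Phase.proj) hL.diffeomorph (ξL A) (ξH A) :=
  Iff.rfl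

theorem omega_eq_omegaL [FiniteDimensional ℝ F] (A : Fin k) {X Y : 𝓐.LagrangianSection k}
    {X' Y' : 𝓐.HamiltonianSection k} (hX : Related (pr' := Phase.proj) hL.diffeomorph X X')
    (hY : Related (pr' := Phase.proj) hL.diffeomorph Y Y') (p : VelocityPhase k F E) :
    𝓐.omega A X' Y' (L.legendre p) = 𝓐.omegaL L A X Y p := by
  have : CompleteSpace EQ := FiniteDimensional.complete ℝ EQ
  have : CompleteSpace F := FiniteDimensional.complete ℝ F
  have h := 𝓐.d₁_eq_of_related (Θ := L.theta A) (Θ' := liouvilleTheta A)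
    (fun p a v => L.liouvilleTheta_legendre A p a v _) hX hY p
  exact congrArg Neg.neg h

/-- For related test sections the two equations agree term by term at `p` and `Leg p`; the minus
sign before `∂H/∂t^A` absorbs the one from `timeDeriv_hamiltonian`. -/
theorem isEulerLagrangeSolution_iff [FiniteDimensional ℝ F] {ξL : Fin k → 𝓐.LagrangianSection k}
    {ξH : Fin k → 𝓐.HamiltonianSection k} (h : 𝓐.LegendreRelated L ξL ξH) :
    𝓐.IsEulerLagrangeSolution L ξL ↔ 𝓐.IsHamiltonSolution (L.hamiltonian hL) ξH := by
  let Φ := hL.diffeomorph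
  have hr : ∀ A, Related (pr' := Phase.proj) Φ (ξL A) (ξH A) := h
  refine and_congr ?_ ?_
  · refine forall₂_congr fun A B => ?_
    refine Iff.trans ?_ Φ.surjective.forall.symm
    refine forall_congr' fun p => ?_
    have h1 : dt EQ B (Φ p) ((ξH A).anchor (Φ p)) = dt EQ B p ((ξL A).anchor p) := by
      rw [(hr A).anchor_eq p]
      exact L.dt_mfderiv_legendre hL B p _
    change _ ↔ dt EQ B (Φ p) ((ξH A).anchor (Φ p)) = _
    rw [h1]
  · have key : ∀ (Y : 𝓐.LagrangianSection k) (Y' : 𝓐.HamiltonianSection k),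
        Related (pr' := Phase.proj) Φ Y Y' → ∀ p,
        (∑ A, 𝓐.omegaL L A (ξL A) Y p =
          𝓐.d₀ _ _ L.energy Y p + ∑ A, timeDeriv L A p * dt EQ A p (Y.anchor p) ↔
        ∑ A, 𝓐.omega A (ξH A) Y' (Φ p) = 𝓐.d₀ _ _ (L.hamiltonian hL) Y' (Φ p) -
          ∑ A, timeDeriv (L.hamiltonian hL) A (Φ p) * dt EQ A (Φ p) (Y'.anchor (Φ p))) := by
      intro Y Y' hY p
      have h1 : ∀ A, 𝓐.omega A (ξH A) Y' (Φ p) = 𝓐.omegaL L A (ξL A) Y p := fun A =>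
        𝓐.omega_eq_omegaL hL A (hr A) hY p
      have h2 : 𝓐.d₀ _ _ (L.hamiltonian hL) Y' (Φ p) = 𝓐.d₀ _ _ L.energy Y p := by
        refine (𝓐.d₀_eq_of_related hY (L.hamiltonian hL) p).trans ?_
        have : (fun x => L.hamiltonian hL (Φ x)) = L.energy :=
          funext fun x => L.hamiltonian_legendre hL x
        rw [this]
        rfl
      have h3 : ∀ A, timeDeriv (L.hamiltonian hL) A (Φ p) = -timeDeriv L A p := fun A =>
        L.timeDeriv_hamiltonian hL A p
      have h4 : ∀ A, dt EQ A (Φ p) (Y'.anchor (Φ p)) = dt EQ A p (Y.anchor p) := fun A => by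
        rw [hY.anchor_eq p]
        exact L.dt_mfderiv_legendre hL A p _
      simp only [h1, h2, h3, h4, neg_mul, Finset.sum_neg_distrib, sub_neg_eq_add]
    -- Every test section on one side is related to one on the other, and `Φ` is onto, so testing
    -- against all sections at all points is the same condition on both sides.
    constructor
    · intro hE Y' q
      obtain ⟨Y, hY⟩ := exists_related_left Φ Y'
      obtain ⟨p, rfl⟩ := Φ.surjective q
      exact (key Y Y' hY p).1 (hE Y p)
    · intro hH Y p
      obtain ⟨Y', hY⟩ := exists_related_right (pr' := Phase.proj) Φ Y
      exact (key Y Y' hY p).2 (hH Y' _)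

end LieAlgebroid

end FieldTheory

/-! ### The theorem. -/

theorem mainTheorem4 {k : ℕ} {EQ F Q : Type*} {E : Q → Type*}
    [NormedAddCommGroup EQ] [NormedSpace ℝ EQ] [FiniteDimensional ℝ EQ]
    [NormedAddCommGroup F] [NormedSpace ℝ F] [FiniteDimensional ℝ F]
    [TopologicalSpace Q] [T2Space Q] [ChartedSpace EQ Q] [IsManifold 𝓘(ℝ, EQ) ∞ Q]
    [∀ q, AddCommGroup (E q)] [∀ q, Module ℝ (E q)] [∀ q, TopologicalSpace (E q)]
    [TopologicalSpace (TotalSpace F E)] [FiberBundle F E] [VectorBundle ℝ F E]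
    [ContMDiffVectorBundle ∞ F E 𝓘(ℝ, EQ)]
    (𝓐 : LieAlgebroid EQ F E) (L : Lagrangian k EQ F E) (hL : L.IsHyperregular) :
    (∀ ξL : Fin k → 𝓐.LagrangianSection k, ∃! ξH : Fin k → 𝓐.HamiltonianSection k,
      𝓐.LegendreRelated L ξL ξH) ∧
    (∀ ξH : Fin k → 𝓐.HamiltonianSection k, ∃! ξL : Fin k → 𝓐.LagrangianSection k,
      𝓐.LegendreRelated L ξL ξH) ∧
    (∀ (ξL : Fin k → 𝓐.LagrangianSection k) (ξH : Fin k → 𝓐.HamiltonianSection k),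
      𝓐.LegendreRelated L ξL ξH →
        (𝓐.IsEulerLagrangeSolution L ξL ↔ 𝓐.IsHamiltonSolution (L.hamiltonian hL) ξH) ∧
        ∀ η : (Fin k → ℝ) → VelocityPhase k F E,
          IsIntegralSection (phaseModel k EQ F) (fun A => (ξL A).anchor) η ↔
            IsIntegralSection (phaseModel k EQ (F →L[ℝ] ℝ)) (fun A => (ξH A).anchor)
              (fun t => L.legendre (η t))) ∧
    Set.BijOn (fun (η : (Fin k → ℝ) → VelocityPhase k F E) t => L.legendre (η t))
      {η | ∃ ξL : Fin k → 𝓐.LagrangianSection k, 𝓐.IsEulerLagrangeSolution L ξL ∧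
        IsIntegralSection (phaseModel k EQ F) (fun A => (ξL A).anchor) η}
      {ψ | ∃ ξH : Fin k → 𝓐.HamiltonianSection k,
        𝓐.IsHamiltonSolution (L.hamiltonian hL) ξH ∧
        IsIntegralSection (phaseModel k EQ (F →L[ℝ] ℝ)) (fun A => (ξH A).anchor) ψ} := by
  let Φ := hL.diffeomorph
  have exR : ∀ ξL : Fin k → 𝓐.LagrangianSection k, ∃ ξH : Fin k → 𝓐.HamiltonianSection k,
      𝓐.LegendreRelated L ξL ξH := fun ξL => by
    choose ξH h using fun A =>
      LieAlgebroid.ProlongationSection.exists_related_right (pr' := Phase.proj) Φ (ξL A)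
    exact ⟨ξH, h⟩
  have exL : ∀ ξH : Fin k → 𝓐.HamiltonianSection k, ∃ ξL : Fin k → 𝓐.LagrangianSection k,
      𝓐.LegendreRelated L ξL ξH := fun ξH => by
    choose ξL h using fun A => LieAlgebroid.ProlongationSection.exists_related_left Φ (ξH A)
    exact ⟨ξL, h⟩
  have hEH : ∀ (ξL : Fin k → 𝓐.LagrangianSection k) (ξH : Fin k → 𝓐.HamiltonianSection k),
      𝓐.LegendreRelated L ξL ξH →
        (𝓐.IsEulerLagrangeSolution L ξL ↔ 𝓐.IsHamiltonSolution (L.hamiltonian hL) ξH) ∧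
        ∀ η : (Fin k → ℝ) → VelocityPhase k F E,
          IsIntegralSection (phaseModel k EQ F) (fun A => (ξL A).anchor) η ↔
            IsIntegralSection (phaseModel k EQ (F →L[ℝ] ℝ)) (fun A => (ξH A).anchor)
              (fun t => L.legendre (η t)) := fun ξL ξH h =>
    ⟨𝓐.isEulerLagrangeSolution_iff hL h,
      isIntegralSection_comp_diffeomorph_iff Φ fun A => ((𝓐.legendreRelated_iff hL).1 h A).anchor_eq⟩
  refine ⟨fun ξL => ?_, fun ξH => ?_, hEH, ?_, ?_, ?_⟩
  · obtain ⟨ξH, h⟩ := exR ξL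
    exact ⟨ξH, h, fun ξ' h' => funext fun A =>
      ((𝓐.legendreRelated_iff hL).1 h' A).right_unique ((𝓐.legendreRelated_iff hL).1 h A)⟩
  · obtain ⟨ξL, h⟩ := exL ξH
    exact ⟨ξL, h, fun ξ' h' => funext fun A =>
      ((𝓐.legendreRelated_iff hL).1 h' A).left_unique ((𝓐.legendreRelated_iff hL).1 h A)⟩
  · rintro η ⟨ξL, hξ, hη⟩
    obtain ⟨ξH, h⟩ := exR ξL
    exact ⟨ξH, (hEH ξL ξH h).1.1 hξ, ((hEH ξL ξH h).2 η).1 hη⟩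
  · intro η _ η' _ h
    exact funext fun t => Φ.injective (congrFun h t)
  · rintro ψ ⟨ξH, hξ, hψ⟩
    obtain ⟨ξL, h⟩ := exL ξH
    -- The preimage of `ψ` is `Leg⁻¹ ∘ ψ`, an integral section of the family `ξL` that corresponds
    -- to `ξH`.
    have hc : (fun t => L.legendre (Φ.symm (ψ t))) = ψ :=
      funext fun t => Φ.apply_symm_apply (ψ t)
    refine ⟨fun t => Φ.symm (ψ t), ⟨ξL, (hEH ξL ξH h).1.2 hξ, ((hEH ξL ξH h).2 _).2 ?_⟩, hc⟩
    rwa [hc]
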